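/- Let $G$ be a compact Hausdorff second countable group and $M$ a type $\mathrm{III}$ factor with separable predual, acting on its standard space $L^2(M)$ with its right $M$-action. Give $\mathrm{Aut}(M)$ the topology of pointwise norm convergence on the predual $M_*$, and let $\mathrm{Out}(M)=\mathrm{Aut}(M)/\mathrm{Inn}(M)$. Let $\theta\colon G\to\mathrm{Out}(M)$ be a $G$-kernel, i.e. an injective homomorphism admitting a Borel lift, and let $\alpha\colon G\to\mathrm{Aut}(M)$ be a Borel lift of $\theta$, i.e. a Borel map with $[\alpha_g]=\theta_g$ for all $g\in G$. Let $\mu$ be a finite Borel measure on $G$. Call a Borel set $E\subseteq G$ proper if $\mu(E)>0$ and $\mu(G\setminus E)>0$, and for such $E$ put $\mu_E(A)=\mu(A\cap E)$. Let $\sigma_{\mu_E}(m)=\int_G\alpha_g(m)\otimes \mathrm{d}E_{\mu_E}(g)$ on $L^2(M)\otimes L^2(G,\mu_E)$, where $E_{\mu_E}(A)$ is multiplication by the indicator function $1_A$ on $L^2(G,\mu_E)$. For every proper $E$ choose a unitary right $M$-modular map $U_E\colon L^2(M)\otimes L^2(G,\mu_E)\to L^2(M)$, and let $\rho_{\mu_E}(m)=U_E\,\sigma_{\mu_E}(m)\,U_E^*$,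 an endomorphism of $M$. For endomorphisms $\rho,\tau$ of $M$ let $(\rho,\tau)$ be the space of bounded right $M$-modular maps $T\colon L^2(M)\to L^2(M)$ with $T\rho(m)=\tau(m)T$ for all $m\in M$. Then, for every such choice of the unitaries $U_E$, the following two conditions are equivalent. (i) For all proper Borel sets $E,F\subseteq G$ with $\mu(E\cap F)=0$ one has $(\rho_{\mu_E},\rho_{\mu_F})=0$. (ii) For every proper Borel set $E\subseteq G$ one has $(\rho_{\mu_E},\rho_{\mu_{G\setminus E}})=0$. -/

import Mathlib

open MeasureTheory Topology

noncomputable section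

namespace GKernel

/-! ### Type III factors in standard form -/

section Factor

variable {H : Type*} [NormedAddCommGroup H] [InnerProductSpace ℂ H] [CompleteSpace H]

/-- The `*`-algebra of elements of a von Neumann algebra. -/
abbrev Alg (M : VonNeumannAlgebra H) : Type _ := ↥M.toStarSubalgebra

instance isClosed_alg (M : VonNeumannAlgebra H) :
    IsClosed (M.toStarSubalgebra : Set (H →L[ℂ] H)) := by
  have h : (M.toStarSubalgebra : Set (H →L[ℂ] H))
      = Set.centralizer (Set.centralizer (M : Set (H →L[ℂ] H))) := by
    rw [M.centralizer_centralizer]; rfl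
  rw [h]
  exact Set.isClosed_centralizer _

/-- `M` is a factor: it is nonzero and its centre consists of scalars. -/
def IsFactor (M : VonNeumannAlgebra H) : Prop :=
  Nontrivial H ∧ ∀ z ∈ M, z ∈ M.commutant → ∃ c : ℂ, z = c • (1 : H →L[ℂ] H)

/-- A projection `p` of `M` is finite if it is not Murray–von Neumann equivalent to a proper
subprojection of itself. The equation `p * (u * star u) = u * star u` says `u * star u ≤ p`. -/
def IsFiniteProjection (M : VonNeumannAlgebra H) (p : H →L[ℂ] H) : Prop :=
  p ∈ M ∧ IsStarProjection p ∧
    ∀ u ∈ M, star u * u = p → p * (u * star u) = u * star u → u * star u = p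

/-- `M` is a factor of type III: its only finite projection is zero. -/
def IsTypeIIIFactor (M : VonNeumannAlgebra H) : Prop :=
  IsFactor M ∧ ∀ p, IsFiniteProjection M p → p = 0

/-- A standard form `(M, H, J, P)` of the von Neumann algebra `M` in the sense of Haagerup, where
`J` is a conjugate-linear isometric involution and `P` a self-dual cone in `H`. It exists for every
von Neumann algebra and is unique up to a unique unitary; then `H = L²(M)`. -/
structure StandardForm (M : VonNeumannAlgebra H) where
  J : H ≃ₗᵢ⋆[ℂ] H
  P : Set H
  J_J : ∀ ξ, J (J ξ) = ξ
  selfDual : ∀ ξ, ξ ∈ P ↔ ∀ η ∈ P, 0 ≤ (inner ℂ ξ η).re ∧ (inner ℂ ξ η).im = 0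
  J_mem_commutant : ∀ y : H →L[ℂ] H, y ∈ M.commutant ↔ ∃ x ∈ M, ∀ ξ, y ξ = J (x (J ξ))
  J_center : ∀ z ∈ M, z ∈ M.commutant → ∀ ξ, J (z (J ξ)) = star z ξ
  J_cone : ∀ ξ ∈ P, J ξ = ξ
  cone_invariant : ∀ x ∈ M, ∀ ξ ∈ P, x (J (x (J ξ))) ∈ P

variable {M : VonNeumannAlgebra H}

/-- The right action of `M` on `L²(M)`: `ξ · x = J x* J ξ`. -/
def rightMul (S : StandardForm M) (x : Alg M) : H →L[ℂ] H :=
  (S.J : H →L⋆[ℂ] H).comp ((star (x : H →L[ℂ] H)).comp (S.J : H →L⋆[ℂ] H))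

theorem rightMul_apply (S : StandardForm M) (x : Alg M) (ξ : H) :
    rightMul S x ξ = S.J (star (x : H →L[ℂ] H) (S.J ξ)) := rfl

/-- The bounded operators on `L²(M)` commuting with the right action of `M` are those in `M`. -/
theorem mem_of_rightMul (S : StandardForm M) (T : H →L[ℂ] H)
    (hT : ∀ x ξ, T (rightMul S x ξ) = rightMul S x (T ξ)) : T ∈ M := by
  rw [← M.commutant_commutant, VonNeumannAlgebra.mem_commutant_iff]
  intro y hy
  obtain ⟨x, hx, hxy⟩ := (S.J_mem_commutant y).1 hy
  ext ξ
  have h := hT ⟨star x, star_mem hx⟩ ξ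
  simp only [rightMul_apply, star_star] at h
  simp only [mul_apply_eq_comp, hxy]
  exact h.symm

/-! ### Automorphisms -/

/-- The group of `*`-automorphisms of `M`. -/
abbrev VNAut (M : VonNeumannAlgebra H) : Type _ := Alg M ≃⋆ₐ[ℂ] Alg M

/-- A `*`-automorphism of `M` as a bounded linear map. -/
def VNAut.toCLM (a : VNAut M) : Alg M →L[ℂ] Alg M where
  toFun := a
  map_add' := map_add a
  map_smul' := map_smul a
  cont := (StarAlgEquiv.isometry a).continuous

/-- Membership in the predual `M_*`: the bounded functionals
`m ↦ ∑ ⟪ξ n, m (η n)⟫` with `∑ ‖ξ n‖² < ∞` and `∑ ‖η n‖² < ∞`. -/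
def IsNormalFunctional (φ : StrongDual ℂ (Alg M)) : Prop :=
  ∃ ξ η : ℕ → H, Summable (fun n => ‖ξ n‖ ^ 2) ∧ Summable (fun n => ‖η n‖ ^ 2) ∧
    ∀ m : Alg M, HasSum (fun n => inner ℂ (ξ n) ((m : H →L[ℂ] H) (η n))) (φ m)

/-- The `u`-topology on `Aut(M)`: `a_i → a` iff `‖φ ∘ a_i - φ ∘ a‖ → 0` for all `φ ∈ M_*`. -/
instance VNAut.topologicalSpace : TopologicalSpace (VNAut M) :=
  ⨅ φ : {φ : StrongDual ℂ (Alg M) // IsNormalFunctional φ},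
    TopologicalSpace.induced (fun a : VNAut M => φ.1.comp (VNAut.toCLM a)) inferInstance

instance VNAut.measurableSpace : MeasurableSpace (VNAut M) := borel _

instance VNAut.borelSpace : BorelSpace (VNAut M) := ⟨rfl⟩

/-- The group of inner automorphisms `Ad v`, `v` a unitary of `M`. -/
def inn (M : VonNeumannAlgebra H) : Subgroup (VNAut M) :=
  (Unitary.conjStarAlgAut ℂ (Alg M)).range

instance inn_normal (M : VonNeumannAlgebra H) : (inn M).Normal where
  conj_mem := by
    rintro _ ⟨v, rfl⟩ a
    refine ⟨⟨a v, ?_, ?_⟩, ?_⟩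
    · have h := Unitary.star_mul_self_of_mem v.2
      rw [← map_star, ← map_mul, h, map_one]
    · have h := Unitary.mul_star_self_of_mem v.2
      rw [← map_star, ← map_mul, h, map_one]
    · refine StarAlgEquiv.ext fun x => ?_
      simp [StarAlgEquiv.aut_inv, map_star]

/-- `Out(M) = Aut(M) / Inn(M)`. -/
abbrev Out (M : VonNeumannAlgebra H) : Type _ := VNAut M ⧸ inn M

/-- `α` is a Borel lift of `θ : G → Out(M)`. -/
def IsBorelLift {G : Type*} [Group G] [MeasurableSpace G] (θ : G →* Out M) (α : G → VNAut M) :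
    Prop :=
  Measurable α ∧ ∀ g, (QuotientGroup.mk (α g) : Out M) = θ g

/-- A `G`-kernel: a monomorphism `G → Out(M)` that has a Borel lift. -/
def IsGKernel {G : Type*} [Group G] [MeasurableSpace G] (θ : G →* Out M) : Prop :=
  Function.Injective θ ∧ ∃ α : G → VNAut M, IsBorelLift θ α

theorem isNormalFunctional_vector (φ : StrongDual ℂ (Alg M)) (ξ η : H)
    (h : ∀ m : Alg M, φ m = inner ℂ ξ ((m : H →L[ℂ] H) η)) : IsNormalFunctional φ := by
  refine ⟨Pi.single 0 ξ, Pi.single 0 η, ?_, ?_, fun m => ?_⟩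
  · exact summable_of_ne_finset_zero (s := {0}) fun n hn => by
      simp [Pi.single_eq_of_ne (by simpa using hn : n ≠ 0)]
  · exact summable_of_ne_finset_zero (s := {0}) fun n hn => by
      simp [Pi.single_eq_of_ne (by simpa using hn : n ≠ 0)]
  · rw [h m]
    have h1 := hasSum_single (f := fun n => inner ℂ ((Pi.single 0 ξ : ℕ → H) n)
      ((m : H →L[ℂ] H) ((Pi.single 0 η : ℕ → H) n))) 0
      fun n hn => by simp [Pi.single_eq_of_ne hn]
    simpa using h1

theorem continuous_inner_apply (m : Alg M) (ξ η : H) :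
    Continuous fun a : VNAut M => inner ℂ ξ ((a m : H →L[ℂ] H) η) := by
  let φ : StrongDual ℂ (Alg M) :=
    (innerSL ℂ ξ).comp ((ContinuousLinearMap.apply ℂ H η).comp
      (⟨M.toStarSubalgebra.subtype.toLinearMap, continuous_subtype_val⟩ :
        Alg M →L[ℂ] (H →L[ℂ] H)))
  have hφ : IsNormalFunctional φ := isNormalFunctional_vector φ ξ η fun m => rfl
  have h1 : Continuous fun a : VNAut M => φ.comp (VNAut.toCLM a) :=
    continuous_iff_le_induced.2 (iInf_le_of_le ⟨φ, hφ⟩ le_rfl)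
  exact (ContinuousLinearMap.apply ℂ ℂ m).continuous.comp h1

theorem continuous_apply (m : Alg M) (v : H) :
    Continuous fun a : VNAut M => (a m : H →L[ℂ] H) v := by
  have hsq : ∀ a : VNAut M, inner ℂ v ((a (star m * m) : H →L[ℂ] H) v)
      = inner ℂ ((a m : H →L[ℂ] H) v) ((a m : H →L[ℂ] H) v) := by
    intro a
    rw [map_mul, map_star]
    simp [ContinuousLinearMap.star_eq_adjoint, ContinuousLinearMap.adjoint_inner_right]
  rw [continuous_iff_continuousAt]
  intro b
  rw [ContinuousAt, tendsto_iff_norm_sub_tendsto_zero]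
  have key : Filter.Tendsto (fun a : VNAut M => ‖(a m : H →L[ℂ] H) v - (b m : H →L[ℂ] H) v‖ ^ 2)
      (𝓝 b) (𝓝 0) := by
    have e : (fun a : VNAut M => ‖(a m : H →L[ℂ] H) v - (b m : H →L[ℂ] H) v‖ ^ 2)
        = fun a : VNAut M => (inner ℂ v ((a (star m * m) : H →L[ℂ] H) v)).re
          - 2 * (inner ℂ ((b m : H →L[ℂ] H) v) ((a m : H →L[ℂ] H) v)).re
          + ‖(b m : H →L[ℂ] H) v‖ ^ 2 := by
      funext a
      rw [@norm_sub_sq ℂ, hsq, ← inner_re_symm]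
      simp [inner_self_eq_norm_sq_to_K, ← Complex.ofReal_pow]
    have hc : Continuous fun a : VNAut M => (inner ℂ v ((a (star m * m) : H →L[ℂ] H) v)).re
          - 2 * (inner ℂ ((b m : H →L[ℂ] H) v) ((a m : H →L[ℂ] H) v)).re
          + ‖(b m : H →L[ℂ] H) v‖ ^ 2 :=
      ((Complex.continuous_re.comp (continuous_inner_apply _ _ _)).sub
        (continuous_const.mul
          (Complex.continuous_re.comp (continuous_inner_apply _ _ _)))).add continuous_const
    have h0 := congrFun e b
    rw [e]
    have h1 := hc.tendsto b
    rw [← h0] at h1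
    simpa using h1
  have := (Real.continuous_sqrt.tendsto 0).comp key
  simpa [Function.comp_def, Real.sqrt_sq] using this

end Factor

/-! ### Direct integrals of automorphisms -/

section Integral

variable {H : Type*} [NormedAddCommGroup H] [InnerProductSpace ℂ H] [CompleteSpace H]
variable {M : VonNeumannAlgebra H} {X : Type*} [MeasurableSpace X]

theorem norm_aut_apply (a : VNAut M) (m : Alg M) : ‖(a m : H →L[ℂ] H)‖ = ‖(m : H →L[ℂ] H)‖ :=
  StarAlgEquiv.norm_map a m

theorem memLp_aut_apply [TopologicalSpace.SeparableSpace H] {β : X → VNAut M} (hβ : Measurable β)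
    (ν : Measure X) (m : Alg M) (f : Lp H 2 ν) :
    MemLp (fun x => (β x m : H →L[ℂ] H) (f x)) 2 ν := by
  borelize H
  have : SecondCountableTopology H := UniformSpace.secondCountable_of_separable H
  have h1 : StronglyMeasurable (Function.uncurry fun (v : H) (x : X) =>
      (β x m : H →L[ℂ] H) v) :=
    stronglyMeasurable_uncurry_of_continuous_of_stronglyMeasurable
      (fun x => (β x m : H →L[ℂ] H).continuous)
      fun v => ((continuous_apply m v).measurable.comp hβ).stronglyMeasurable
  have h2 : AEStronglyMeasurable (fun x => (β x m : H →L[ℂ] H) (f x)) ν := by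
    have h3 : StronglyMeasurable fun x => (β x m : H →L[ℂ] H) (f x) :=
      h1.comp_measurable ((Lp.stronglyMeasurable f).measurable.prodMk measurable_id)
    exact h3.aestronglyMeasurable
  refine (Lp.memLp f).of_le_mul (c := ‖(m : H →L[ℂ] H)‖) h2 (Filter.Eventually.of_forall fun x => ?_)
  refine ((β x m : H →L[ℂ] H).le_opNorm (f x)).trans_eq ?_
  rw [norm_aut_apply]

/-- The operator `∫ β_x(m) ⊗ dE(x)` on `H ⊗ L²(X, ν) = L²(X, ν; H)`, where `E` is the spectral
measure of multiplication by indicator functions; it acts by `f ↦ (x ↦ β_x(m) f(x))`.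
See `inner_sigmaOp_tensor` for the description through the spectral measure. -/
def sigmaOp [TopologicalSpace.SeparableSpace H] {β : X → VNAut M} (hβ : Measurable β)
    (ν : Measure X) (m : Alg M) : Lp H 2 ν →L[ℂ] Lp H 2 ν :=
  LinearMap.mkContinuous
    { toFun := fun f => (memLp_aut_apply hβ ν m f).toLp
      map_add' := fun f g => by
        refine Lp.ext ?_
        filter_upwards [(memLp_aut_apply hβ ν m (f + g)).coeFn_toLp,
          (memLp_aut_apply hβ ν m f).coeFn_toLp, (memLp_aut_apply hβ ν m g).coeFn_toLp,
          Lp.coeFn_add f g, Lp.coeFn_add (memLp_aut_apply hβ ν m f).toLp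
            (memLp_aut_apply hβ ν m g).toLp] with x h1 h2 h3 h4 h5
        rw [h1, h5, Pi.add_apply, h2, h3, h4, Pi.add_apply, map_add]
      map_smul' := fun c f => by
        refine Lp.ext ?_
        filter_upwards [(memLp_aut_apply hβ ν m (c • f)).coeFn_toLp,
          (memLp_aut_apply hβ ν m f).coeFn_toLp,
          Lp.coeFn_smul c f, Lp.coeFn_smul c (memLp_aut_apply hβ ν m f).toLp] with x h1 h2 h3 h4
        rw [RingHom.id_apply, h1, h4, Pi.smul_apply, h2, h3, Pi.smul_apply, map_smul] }
    ‖(m : H →L[ℂ] H)‖ fun f => by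
      refine Lp.norm_le_mul_norm_of_ae_le_mul ?_
      filter_upwards [(memLp_aut_apply hβ ν m f).coeFn_toLp] with x h1
      refine (le_of_eq (congrArg norm h1)).trans ?_
      refine ((β x m : H →L[ℂ] H).le_opNorm (f x)).trans_eq ?_
      rw [norm_aut_apply]

theorem coeFn_sigmaOp [TopologicalSpace.SeparableSpace H] {β : X → VNAut M} (hβ : Measurable β)
    (ν : Measure X) (m : Alg M) (f : Lp H 2 ν) :
    sigmaOp hβ ν m f =ᵐ[ν] fun x => (β x m : H →L[ℂ] H) (f x) :=
  (memLp_aut_apply hβ ν m f).coeFn_toLp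

/-- The elementary tensor `ξ ⊗ h` in `H ⊗ L²(X, ν) = L²(X, ν; H)`. -/
def tensor {ν : Measure X} (ξ : H) (h : Lp ℂ 2 ν) : Lp H 2 ν :=
  ((1 : ℂ →L[ℂ] ℂ).smulRight ξ).compLp h

/-- `⟪ξ ⊗ h, σ(m) (η ⊗ k)⟫ = ∫ ⟪ξ, β_x(m) η⟫ d⟪h, E(x) k⟫`, where
`⟪h, E(A) k⟫ = ∫_A conj (h x) * k x dν`. -/
theorem inner_sigmaOp_tensor [TopologicalSpace.SeparableSpace H] {β : X → VNAut M}
    (hβ : Measurable β) (ν : Measure X) (m : Alg M) (ξ η : H) (h k : Lp ℂ 2 ν) :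
    inner ℂ (tensor ξ h) (sigmaOp hβ ν m (tensor η k))
      = ∫ x, inner ℂ ξ ((β x m : H →L[ℂ] H) η) * (star (h x) * k x) ∂ν := by
  rw [L2.inner_def]
  refine integral_congr_ae ?_
  filter_upwards [coeFn_sigmaOp hβ ν m (tensor η k),
    ((1 : ℂ →L[ℂ] ℂ).smulRight ξ).coeFn_compLp h,
    ((1 : ℂ →L[ℂ] ℂ).smulRight η).coeFn_compLp k] with x h1 h2 h3
  rw [h1]
  change inner ℂ (((1 : ℂ →L[ℂ] ℂ).smulRight ξ).compLp h x)
    ((β x m : H →L[ℂ] H) (((1 : ℂ →L[ℂ] ℂ).smulRight η).compLp k x)) = _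
  rw [h2, h3]
  simp only [ContinuousLinearMap.smulRight_apply, one_apply_eq_self, map_smul,
    inner_smul_left, inner_smul_right, starRingEnd_apply]
  ring

/-- The `*`-morphism `σ : M → M ⊗ B(L²(X, ν))`, `σ(m) = ∫ β_x(m) ⊗ dE(x)`. For a triple
`(X, ν, g)` and a map `α : G → Aut(M)` one takes `β x = α (g x)`. -/
def sigma [TopologicalSpace.SeparableSpace H] {β : X → VNAut M} (hβ : Measurable β)
    (ν : Measure X) : Alg M →⋆ₐ[ℂ] (Lp H 2 ν →L[ℂ] Lp H 2 ν) where
  toFun := sigmaOp hβ ν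
  map_one' := by
    refine ContinuousLinearMap.ext fun f => Lp.ext ?_
    filter_upwards [coeFn_sigmaOp hβ ν 1 f] with x h1
    rw [h1, map_one]; rfl
  map_zero' := by
    refine ContinuousLinearMap.ext fun f => Lp.ext ?_
    filter_upwards [coeFn_sigmaOp hβ ν 0 f, Lp.coeFn_zero H 2 ν] with x h1 h2
    rw [h1, map_zero, zero_apply, h2]; rfl
  map_mul' m n := by
    refine ContinuousLinearMap.ext fun f => Lp.ext ?_
    filter_upwards [coeFn_sigmaOp hβ ν (m * n) f, coeFn_sigmaOp hβ ν n f,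
      coeFn_sigmaOp hβ ν m (sigmaOp hβ ν n f)] with x h1 h2 h3
    rw [h1, mul_apply_eq_comp, h3, h2, map_mul]; rfl
  map_add' m n := by
    refine ContinuousLinearMap.ext fun f => Lp.ext ?_
    filter_upwards [coeFn_sigmaOp hβ ν (m + n) f, coeFn_sigmaOp hβ ν n f,
      coeFn_sigmaOp hβ ν m f, Lp.coeFn_add (sigmaOp hβ ν m f) (sigmaOp hβ ν n f)] with x h1 h2 h3 h4
    rw [h1, add_apply, h4, Pi.add_apply, h3, h2, map_add]; rfl
  commutes' c := by
    refine ContinuousLinearMap.ext fun f => Lp.ext ?_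
    have h : (algebraMap ℂ (Lp H 2 ν →L[ℂ] Lp H 2 ν) c) f = c • f := by
      simp [Algebra.algebraMap_eq_smul_one]
    rw [h]
    filter_upwards [coeFn_sigmaOp hβ ν (algebraMap ℂ _ c) f, Lp.coeFn_smul c f] with x h1 h2
    rw [h1, h2, Algebra.algebraMap_eq_smul_one, map_smul, map_one]; rfl
  map_star' m := by
    rw [ContinuousLinearMap.star_eq_adjoint, ContinuousLinearMap.eq_adjoint_iff]
    intro f k
    rw [L2.inner_def, L2.inner_def]
    refine integral_congr_ae ?_
    filter_upwards [coeFn_sigmaOp hβ ν (star m) f, coeFn_sigmaOp hβ ν m k] with x h1 h2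
    rw [h1, h2, map_star]
    change inner ℂ ((star (β x m : H →L[ℂ] H)) (f x)) (k x) = _
    rw [ContinuousLinearMap.star_eq_adjoint, ContinuousLinearMap.adjoint_inner_left]

/-! ### The endomorphisms `ρ` and their intertwiners -/

/-- The right action of `M` on `L²(M) ⊗ L²(X, ν) = L²(X, ν; L²(M))`,
`(ξ ⊗ h) · x = (ξ · x) ⊗ h`. -/
def ampRightMul (S : StandardForm M) (ν : Measure X) (x : Alg M) : Lp H 2 ν →L[ℂ] Lp H 2 ν :=
  (rightMul S x).compLpL 2 ν

/-- `σ` takes its values in the right `M`-modular operators. -/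
theorem sigma_ampRightMul [TopologicalSpace.SeparableSpace H] (S : StandardForm M) {β : X → VNAut M}
    (hβ : Measurable β) (ν : Measure X) (m x : Alg M) (f : Lp H 2 ν) :
    sigma hβ ν m (ampRightMul S ν x f) = ampRightMul S ν x (sigma hβ ν m f) := by
  refine Lp.ext ?_
  have hx : rightMul S x ∈ M.commutant :=
    (S.J_mem_commutant _).2 ⟨star (x : H →L[ℂ] H), star_mem x.2, fun ξ => rfl⟩
  filter_upwards [coeFn_sigmaOp hβ ν m (ampRightMul S ν x f), coeFn_sigmaOp hβ ν m f,
    (rightMul S x).coeFn_compLpL f, (rightMul S x).coeFn_compLpL (sigmaOp hβ ν m f)]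
    with y h1 h2 h3 h4
  refine h1.trans (Eq.trans ?_ h4.symm)
  rw [h2]
  change (β y m : H →L[ℂ] H) ((rightMul S x).compLpL 2 ν f y) = _
  rw [h3]
  exact congrArg (fun T : H →L[ℂ] H => T (f y))
    (VonNeumannAlgebra.mem_commutant_iff.1 hx _ (β y m).2)

/-- A unitary right `M`-modular map `L²(M) ⊗ L²(X, ν) → L²(M)`. -/
structure ModularUnitary (S : StandardForm M) (ν : Measure X) where
  toEquiv : Lp H 2 ν ≃ₗᵢ[ℂ] H
  modular : ∀ x f, toEquiv (ampRightMul S ν x f) = rightMul S x (toEquiv f)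

theorem ModularUnitary.conj_mem [TopologicalSpace.SeparableSpace H] {S : StandardForm M}
    {β : X → VNAut M} (hβ : Measurable β) {ν : Measure X} (U : ModularUnitary S ν) (m : Alg M) :
    U.toEquiv.conjStarAlgEquiv (sigma hβ ν m) ∈ M.toStarSubalgebra := by
  refine mem_of_rightMul S _ fun x ξ => ?_
  have h : U.toEquiv.symm (rightMul S x ξ) = ampRightMul S ν x (U.toEquiv.symm ξ) := by
    rw [LinearIsometryEquiv.symm_apply_eq, U.modular, LinearIsometryEquiv.apply_symm_apply]
  simp only [LinearIsometryEquiv.conjStarAlgEquiv_apply_apply]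
  rw [h, sigma_ampRightMul, U.modular]

/-- The endomorphism `ρ = Ad U ∘ σ` of `M`. -/
def rho [TopologicalSpace.SeparableSpace H] {S : StandardForm M} {β : X → VNAut M}
    (hβ : Measurable β) {ν : Measure X} (U : ModularUnitary S ν) : Alg M →⋆ₐ[ℂ] Alg M :=
  StarAlgHom.codRestrict
    (StarAlgHom.comp (StarAlgHomClass.toStarAlgHom U.toEquiv.conjStarAlgEquiv) (sigma hβ ν))
    M.toStarSubalgebra (U.conj_mem hβ)

theorem rho_apply [TopologicalSpace.SeparableSpace H] {S : StandardForm M} {β : X → VNAut M}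
    (hβ : Measurable β) {ν : Measure X} (U : ModularUnitary S ν) (m : Alg M) (ξ : H) :
    (rho hβ U m : H →L[ℂ] H) ξ = U.toEquiv (sigma hβ ν m (U.toEquiv.symm ξ)) := rfl

/-- The space `(ρ, τ)` of intertwiners of two endomorphisms of `M`: the right `M`-modular bounded
maps `T : L²(M) → L²(M)` with `T ρ(m) = τ(m) T` for all `m`. -/
def intertwiners (S : StandardForm M) (ρ τ : Alg M →⋆ₐ[ℂ] Alg M) : Submodule ℂ (H →L[ℂ] H) where
  carrier := {T | (∀ x : Alg M, T * rightMul S x = rightMul S x * T) ∧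
    ∀ m : Alg M, T * (ρ m : H →L[ℂ] H) = (τ m : H →L[ℂ] H) * T}
  zero_mem' := by simp
  add_mem' := by
    rintro T T' ⟨h1, h2⟩ ⟨h3, h4⟩
    exact ⟨fun x => by rw [add_mul, mul_add, h1, h3], fun m => by rw [add_mul, mul_add, h2, h4]⟩
  smul_mem' := by
    rintro c T ⟨h1, h2⟩
    exact ⟨fun x => by rw [smul_mul_assoc, mul_smul_comm, h1],
      fun m => by rw [smul_mul_assoc, mul_smul_comm, h2]⟩

end Integral

/-- A Borel set `E` is proper (for `μ`) if both `E` and its complement have positive measure. -/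
structure IsProper {G : Type*} [MeasurableSpace G] (μ : Measure G) (E : Set G) : Prop where
  measurableSet : MeasurableSet E
  pos : 0 < μ E
  pos_compl : 0 < μ Eᶜ

theorem IsProper.compl {G : Type*} [MeasurableSpace G] {μ : Measure G} {E : Set G}
    (h : IsProper μ E) : IsProper μ Eᶜ :=
  ⟨h.measurableSet.compl, h.pos_compl, by rw [compl_compl]; exact h.pos⟩

end GKernel

end

/-! Condition (ii) is the case `F = Eᶜ` of (i). For the converse, let `E` and `F` be proper with `μ
(E ∩ F) = 0`. Up to a null set `E` lies in `Fᶜ`, so restricting functions from `Fᶜ` to `E` maps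
`L²(Fᶜ, μ; H)` onto `L²(E, μ; H)`. The right action and `σ` both act fibrewise and therefore commute
with restriction. Conjugating by the chosen unitaries yields a surjective `R` in `(ρ_{Fᶜ}, ρ_E)`
(`exists_surjective_intertwiner_restrict`). If `T` lies in `(ρ_E, ρ_F)`, then `T * R` lies in
`(ρ_{Fᶜ}, ρ_F)`, which vanishes by (ii) for the set `Fᶜ`; since `R` is onto, `T = 0`
(`intertwiners_eq_bot_of_surjective`). -/

namespace GKernel

/-! ### Restriction of square-integrable functions to a measurable subset. -/

section Restriction

variable {H : Type*} [NormedAddCommGroup H] [InnerProductSpace ℂ H]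
  {X : Type*} [MeasurableSpace X]

/-- Extension by zero outside `A` is a right inverse; measurability of `A` makes the extended
function `L²`. -/
theorem LpToLpRestrictCLM_surjective (ν : Measure X) {A : Set X} (hA : MeasurableSet A) :
    Function.Surjective (LpToLpRestrictCLM X H ℂ ν 2 A) := by
  intro g
  have hg : MemLp (A.indicator g) 2 ν := (memLp_indicator_iff_restrict hA).2 (Lp.memLp g)
  refine ⟨hg.toLp, Lp.ext ?_⟩
  filter_upwards [LpToLpRestrictCLM_coeFn (p := 2) ℂ A hg.toLp,
    ae_restrict_of_ae hg.coeFn_toLp, ae_restrict_mem hA] with x h1 h2 h3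
  rw [h1, h2, Set.indicator_of_mem h3]

variable [CompleteSpace H] {M : VonNeumannAlgebra H}

theorem LpToLpRestrictCLM_ampRightMul (S : StandardForm M) (ν : Measure X) (A : Set X)
    (x : Alg M) (f : Lp H 2 ν) :
    LpToLpRestrictCLM X H ℂ ν 2 A (ampRightMul S ν x f)
      = ampRightMul S (ν.restrict A) x (LpToLpRestrictCLM X H ℂ ν 2 A f) := by
  refine Lp.ext ?_
  filter_upwards [LpToLpRestrictCLM_coeFn (p := 2) ℂ A (ampRightMul S ν x f),
    ae_restrict_of_ae ((rightMul S x).coeFn_compLpL f), LpToLpRestrictCLM_coeFn (p := 2) ℂ A f,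
    (rightMul S x).coeFn_compLpL (LpToLpRestrictCLM X H ℂ ν 2 A f)] with y h1 h2 h3 h4
  refine (h1.trans h2).trans (Eq.trans ?_ h4.symm)
  rw [h3]

variable [TopologicalSpace.SeparableSpace H]

/-- The value of `sigma hβ ν m f` at `y` is `β y m` applied to `f y`, which involves neither the
measure nor the other fibres. -/
theorem LpToLpRestrictCLM_sigma {β : X → VNAut M} (hβ : Measurable β) (ν : Measure X)
    (A : Set X) (m : Alg M) (f : Lp H 2 ν) :
    LpToLpRestrictCLM X H ℂ ν 2 A (sigma hβ ν m f)
      = sigma hβ (ν.restrict A) m (LpToLpRestrictCLM X H ℂ ν 2 A f) := by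
  refine Lp.ext ?_
  filter_upwards [LpToLpRestrictCLM_coeFn (p := 2) ℂ A (sigma hβ ν m f),
    ae_restrict_of_ae (coeFn_sigmaOp hβ ν m f), LpToLpRestrictCLM_coeFn (p := 2) ℂ A f,
    coeFn_sigmaOp hβ (ν.restrict A) m (LpToLpRestrictCLM X H ℂ ν 2 A f)] with y h1 h2 h3 h4
  refine (h1.trans h2).trans (Eq.trans ?_ h4.symm)
  rw [h3]

/-- Restriction of functions to `A` induces a surjective intertwiner from the endomorphism given by
`ν` to the one given by `ν.restrict A`. -/
theorem exists_surjective_intertwiner_restrict {S : StandardForm M} {β : X → VNAut M}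
    (hβ : Measurable β) {ν ν' : Measure X} {A : Set X} (hA : MeasurableSet A)
    (h : ν' = ν.restrict A) (U : ModularUnitary S ν) (U' : ModularUnitary S ν') :
    ∃ R ∈ intertwiners S (rho hβ U) (rho hβ U'), Function.Surjective R := by
  -- Keeping `ν'` as a variable tied to `ν.restrict A` by an equation lets `U'` be given over a
  -- measure that is only propositionally equal to the restriction.
  subst h
  -- The intertwiner is `U'` ∘ (restriction to `A`) ∘ `U⁻¹`.
  refine ⟨U'.toEquiv.toLinearIsometry.toContinuousLinearMap.comp
    ((LpToLpRestrictCLM X H ℂ ν 2 A).comp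
      U.toEquiv.symm.toLinearIsometry.toContinuousLinearMap), ⟨fun x => ?_, fun m => ?_⟩, ?_⟩
  · ext ξ
    change U'.toEquiv (LpToLpRestrictCLM X H ℂ ν 2 A (U.toEquiv.symm (rightMul S x ξ)))
      = rightMul S x (U'.toEquiv (LpToLpRestrictCLM X H ℂ ν 2 A (U.toEquiv.symm ξ)))
    have hU : U.toEquiv.symm (rightMul S x ξ) = ampRightMul S ν x (U.toEquiv.symm ξ) := by
      rw [LinearIsometryEquiv.symm_apply_eq, U.modular, LinearIsometryEquiv.apply_symm_apply]
    rw [hU, LpToLpRestrictCLM_ampRightMul, U'.modular]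
  · ext ξ
    change U'.toEquiv (LpToLpRestrictCLM X H ℂ ν 2 A
        (U.toEquiv.symm (U.toEquiv (sigma hβ ν m (U.toEquiv.symm ξ)))))
      = U'.toEquiv (sigma hβ (ν.restrict A) m (U'.toEquiv.symm
        (U'.toEquiv (LpToLpRestrictCLM X H ℂ ν 2 A (U.toEquiv.symm ξ)))))
    rw [LinearIsometryEquiv.symm_apply_apply, LinearIsometryEquiv.symm_apply_apply,
      LpToLpRestrictCLM_sigma]
  · exact U'.toEquiv.surjective.comp
      ((LpToLpRestrictCLM_surjective ν hA).comp U.toEquiv.symm.surjective)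

end Restriction

/-! ### Composition and cancellation of intertwiners. -/

section Intertwiners

variable {H : Type*} [NormedAddCommGroup H] [InnerProductSpace ℂ H] [CompleteSpace H]
  {M : VonNeumannAlgebra H}

theorem intertwiners_mul_mem {S : StandardForm M} {ρ σ τ : Alg M →⋆ₐ[ℂ] Alg M} {T R : H →L[ℂ] H}
    (hT : T ∈ intertwiners S σ τ) (hR : R ∈ intertwiners S ρ σ) :
    T * R ∈ intertwiners S ρ τ :=
  ⟨fun x => by rw [mul_assoc, hR.1, ← mul_assoc, hT.1, mul_assoc],
    fun m => by rw [mul_assoc, hR.2, ← mul_assoc, hT.2, mul_assoc]⟩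

/-- Precomposition `T ↦ T * R` embeds `(σ, τ)` into `(ρ, τ)`, because a surjective `R` can be
cancelled on the right. -/
theorem intertwiners_eq_bot_of_surjective {S : StandardForm M} {ρ σ τ : Alg M →⋆ₐ[ℂ] Alg M}
    {R : H →L[ℂ] H} (hR : R ∈ intertwiners S ρ σ) (hsurj : Function.Surjective R)
    (h : intertwiners S ρ τ = ⊥) : intertwiners S σ τ = ⊥ := by
  refine (Submodule.eq_bot_iff _).2 fun T hT => ?_
  have h0 : T * R = 0 := (Submodule.eq_bot_iff _).1 h _ (intertwiners_mul_mem hT hR)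
  ext ξ
  obtain ⟨η, rfl⟩ := hsurj ξ
  exact congrArg (fun Q : H →L[ℂ] H => Q η) h0

end Intertwiners

/-- The iterated restriction is restriction to `E \ F`, which differs from `E` by the null set `E ∩
F`. -/
theorem restrict_eq_restrict_compl_restrict {X : Type*} [MeasurableSpace X] {μ : Measure X}
    {E F : Set X} (hE : MeasurableSet E) (h : μ (E ∩ F) = 0) :
    μ.restrict E = (μ.restrict Fᶜ).restrict E := by
  rw [Measure.restrict_restrict hE, ← Set.sdiff_eq]
  exact (Measure.restrict_congr_set (sdiff_ae_eq_self.2 h)).symm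

end GKernel

theorem mainTheorem6
    {G : Type*} [Group G] [TopologicalSpace G] [IsTopologicalGroup G] [CompactSpace G]
    [T2Space G] [SecondCountableTopology G] [MeasurableSpace G] [BorelSpace G]
    {H : Type*} [NormedAddCommGroup H] [InnerProductSpace ℂ H] [CompleteSpace H]
    [TopologicalSpace.SeparableSpace H]
    (M : VonNeumannAlgebra H) (hM : GKernel.IsTypeIIIFactor M) (S : GKernel.StandardForm M)
    (θ : G →* GKernel.Out M) (hθ : GKernel.IsGKernel θ)
    (α : G → GKernel.VNAut M) (hα : GKernel.IsBorelLift θ α)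
    (μ : Measure G) [IsFiniteMeasure μ]
    (U : ∀ E : Set G, GKernel.IsProper μ E → GKernel.ModularUnitary S (μ.restrict E)) :
    (∀ (E F : Set G) (hE : GKernel.IsProper μ E) (hF : GKernel.IsProper μ F), μ (E ∩ F) = 0 →
        GKernel.intertwiners S (GKernel.rho hα.1 (U E hE)) (GKernel.rho hα.1 (U F hF)) = ⊥) ↔
    (∀ (E : Set G) (hE : GKernel.IsProper μ E),
        GKernel.intertwiners S (GKernel.rho hα.1 (U E hE))
          (GKernel.rho hα.1 (U Eᶜ hE.compl)) = ⊥) := by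
  constructor
  · intro h E hE
    exact h E Eᶜ hE hE.compl (by rw [Set.inter_compl_self, measure_empty])
  · intro h E F hE hF hEF
    -- Condition (ii) for `Fᶜ` involves the unitary chosen for `Fᶜᶜ`. As `U` depends on the set and
    -- on its properness proof, the identity `Fᶜᶜ = F` is transported by generalizing over `F'`.
    have hc : ∀ (F' : Set G) (hF' : GKernel.IsProper μ F'), F' = F →
        GKernel.intertwiners S (GKernel.rho hα.1 (U Fᶜ hF.compl))
          (GKernel.rho hα.1 (U F' hF')) = ⊥ →
        GKernel.intertwiners S (GKernel.rho hα.1 (U Fᶜ hF.compl))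
          (GKernel.rho hα.1 (U F hF)) = ⊥ := by
      rintro _ _ rfl h'
      exact h'
    obtain ⟨R, hR, hsurj⟩ := GKernel.exists_surjective_intertwiner_restrict hα.1
      hE.measurableSet (GKernel.restrict_eq_restrict_compl_restrict hE.measurableSet hEF)
      (U Fᶜ hF.compl) (U E hE)
    exact GKernel.intertwiners_eq_bot_of_surjective hR hsurj
      (hc Fᶜᶜ hF.compl.compl (compl_compl F) (h Fᶜ hF.compl))
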